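/- All digraphs have no loops and no parallel arcs (opposite arcs $vw$ and $wv$ may both be present). An (oriented) double ray is a digraph $R$ together with a linear order $\le_R$ on $V(R)$ isomorphic to $\mathbb Z$ such that, for all vertices $v,w$ of $R$, exactly one of $vw$, $wv$ is an arc of $R$ if $v$ and $w$ are consecutive in $\le_R$, and neither is an arc of $R$ otherwise. A turn of $R$ is a vertex incident with two outgoing arcs or with two incoming arcs. The double ray $R$ is periodic if it has an endomorphism (a map $V(R)\to V(R)$ sending arcs to arcs of the same direction), different from the identity, that preserves $\le_R$. A digraph $H$ is ubiquitous if every digraph $G$ that contains, for every $k\in\mathbb N$, $k$ pairwise vertex-disjoint subdigraphs isomorphic to $H$ also contains infinitely many pairwise vertex-disjoint subdigraphs isomorphic to $H$. Theorem 3.5. Every non-periodic double ray $R$ with infinitely many turns is non-ubiquitous; that is, there is a digraph that contains $k$ pairwise vertex-disjoint copies of $R$ for every $k\in\mathbb N$, but does not contain infinitely many pairwise vertex-disjoint copies of $R$. -/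

import Mathlib

universe u w

namespace Digraph

/-- A digraph without loops. Together with the fact that the arcs of a `Digraph` form a relation
(so that there are no parallel arcs), this is the usual notion of a digraph; opposite arcs
`vw` and `wv` may both be present. -/
def Loopless {W : Type*} (G : Digraph W) : Prop :=
  ∀ v : W, ¬ G.Adj v v

/-- A copy of the digraph `H` in the digraph `G`, that is, a subdigraph of `G` (not necessarily
induced) together with an isomorphism from `H` to it: an injective map of the vertices that sends
arcs to arcs of the same direction. The subdigraph consists of the images of the vertices and
arcs of `H`. -/
structure Copy {V W : Type*} (H : Digraph V) (G : Digraph W) where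
  toFun : V → W
  injective : Function.Injective toFun
  map_adj : ∀ ⦃v w : V⦄, H.Adj v w → G.Adj (toFun v) (toFun w)

/-- The set of vertices of a copy. -/
def Copy.verts {V W : Type*} {H : Digraph V} {G : Digraph W} (c : Copy H G) : Set W :=
  Set.range c.toFun

/-- `G` contains a family, indexed by `ι`, of pairwise (vertex-)disjoint copies of `H`. -/
def HasDisjointCopies (ι : Type*) {V W : Type*} (H : Digraph V) (G : Digraph W) : Prop :=
  ∃ c : ι → Copy H G, Pairwise fun i j => Disjoint (c i).verts (c j).verts

/-- `H` is ubiquitous: every digraph that contains `k` disjoint copies of `H` for every natural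
number `k` also contains infinitely many disjoint copies of `H`. -/
def IsUbiquitous {V : Type u} (H : Digraph V) : Prop :=
  ∀ (W : Type w) (G : Digraph W), G.Loopless →
    (∀ k : ℕ, HasDisjointCopies (Fin k) H G) → HasDisjointCopies ℕ H G

/-- A digraph on a linearly ordered set of vertices is an (oriented) double ray if the order is
isomorphic to `ℤ`, any two consecutive vertices are joined by exactly one of the two possible arcs,
and there are no arcs between vertices that are not consecutive. -/
structure IsDoubleRay {V : Type*} [LinearOrder V] (R : Digraph V) : Prop where
  orderIso_int : Nonempty (V ≃o ℤ)
  xor_adj_of_covBy : ∀ ⦃v w : V⦄, v ⋖ w → Xor (R.Adj v w) (R.Adj w v)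
  covBy_of_adj : ∀ ⦃v w : V⦄, R.Adj v w → v ⋖ w ∨ w ⋖ v

/-- There is an order-preserving endomorphism other than the identity. -/
def IsPeriodic {V : Type*} [LinearOrder V] (R : Digraph V) : Prop :=
  ∃ f : V → V, (∀ ⦃v w : V⦄, R.Adj v w → R.Adj (f v) (f w)) ∧ Monotone f ∧ f ≠ id

/-- A turn: a vertex incident with two outgoing or two incoming arcs. -/
def IsTurn {V : Type*} (R : Digraph V) (v : V) : Prop :=
  (∃ a b : V, a ≠ b ∧ R.Adj v a ∧ R.Adj v b) ∨ (∃ a b : V, a ≠ b ∧ R.Adj a v ∧ R.Adj b v)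

end Digraph

/-! Encode `R` by a word `ε`, where `ε i` tells whether the `i`-th edge points forward. Take copies
of `R` ("curves") indexed by `ℕ` and grouped into blocks by `Nat.sqrt`. Curves of one block are
disjoint and block `k` has `2k + 1` of them, which gives `k` disjoint copies for every `k`. Curves
of different blocks share one vertex, a source of one curve and a sink of the other. A path that
changes curves there has no turn at that vertex, whereas each of the two curves has one.

With crossings far out and sparse enough, this makes every copy of `R` cover a whole curve, or two
tails running outwards from a crossing (`Covers`). If a tail of `ε` is aperiodic, oriented to the
right by reversal, a copy can never change curves (`IsTrace.covers_of_aperiodic`). If both tails are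
periodic, it changes at most once, and non-periodicity of `R` forces both ends outwards
(`IsTrace.covers_of_periodic`).

Disjoint copies are then limited in number (`not_pairwise_disjoint`). One copy contains a tail of
some curve `k`, which crosses all curves of large index. By the order of the crossings, every other
copy must contain a tail of one of finitely many curves, and two tails of one curve meet. -/

namespace DoubleRay

/-! ### Curves, crossing positions and traces -/

/-- The letter read when traversing, in direction `σ = ±1`, the edge that leaves position `y` of the
double ray with word `ε`. -/
def letter (ε : ℤ → Bool) (y σ : ℤ) : Bool := if σ = 1 then ε y else !ε (y - 1)

/-- The index of the crossing of the curves `n` and `m`. -/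
def stage (n m : ℕ) : ℕ := Nat.pair (max n m - min n m) (max n m)

theorem stage_comm (n m : ℕ) : stage n m = stage m n := by
  unfold stage; rw [max_comm, min_comm]

theorem le_stage_left (n m : ℕ) : n ≤ stage n m :=
  (le_max_left n m).trans (Nat.right_le_pair _ _)

theorem le_stage_right (n m : ℕ) : m ≤ stage n m :=
  (le_max_right n m).trans (Nat.right_le_pair _ _)

/-- This is why the difference of the indices is the first component of the pair: on a fixed curve,
the crossings with smaller curves are ordered by that difference. -/
theorem stage_lt_stage {k n m : ℕ} (hk : k < n) (hn : n < m) : stage m n < stage m k := by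
  unfold stage
  rw [max_eq_left hn.le, min_eq_right hn.le, max_eq_left (hk.trans hn).le,
    min_eq_right (hk.trans hn).le]
  exact Nat.pair_lt_pair_left _ (by omega)

/-- The position on the curve `n` of its crossing with the curve `m`. -/
def pos (x : ℕ → ℤ) (n m : ℕ) : ℤ := if n < m then x (2 * stage n m) else x (2 * stage n m + 1)

/-- The parity of the index of `x` tells which curve is the larger one; the maximum or the
difference stored in `stage` then recovers `m`. -/
theorem pos_inj {x : ℕ → ℤ} (hx : StrictMono x) {n m k : ℕ} (h : pos x n m = pos x n k) :
    m = k := by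
  unfold pos at h
  split_ifs at h with h1 h2 h2
  · have := hx.injective h
    have h3 : stage n m = stage n k := by omega
    unfold stage at h3
    have := (Nat.pair_eq_pair.1 h3).2
    rwa [max_eq_right h1.le, max_eq_right h2.le] at this
  · have := hx.injective h; omega
  · have := hx.injective h; omega
  · have := hx.injective h
    have h3 : stage n m = stage n k := by omega
    unfold stage at h3
    have := (Nat.pair_eq_pair.1 h3).1
    omega

theorem pos_mem (x : ℕ → ℤ) (n m : ℕ) : pos x n m ∈ Set.range x := by
  unfold pos; split_ifs <;> exact ⟨_, rfl⟩

theorem pos_cases (x : ℕ → ℤ) {n m : ℕ} (h : n ≠ m) :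
    ∃ t, n ≤ t ∧ m ≤ t ∧ ((pos x n m = x (2 * t) ∧ pos x m n = x (2 * t + 1)) ∨
      (pos x n m = x (2 * t + 1) ∧ pos x m n = x (2 * t))) := by
  refine ⟨stage n m, le_stage_left n m, le_stage_right n m, ?_⟩
  unfold pos
  rw [stage_comm m n]
  rcases lt_or_gt_of_ne h with h | h
  · left; simp [h, h.not_gt]
  · right; simp [h, h.not_gt]

/-- Crossing positions: alternately sources and sinks of the double ray with word `ε`, with gaps
controlled by `F`. -/
structure IsCrossingSeq (ε : ℤ → Bool) (F : ℤ → ℤ) (X : ℤ) (x : ℕ → ℤ) : Prop where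
  source : ∀ t, ε (x (2 * t) - 1) = false ∧ ε (x (2 * t)) = true
  sink : ∀ t, ε (x (2 * t + 1) - 1) = true ∧ ε (x (2 * t + 1)) = false
  le_zero : X ≤ x 0
  growth : ∀ t, F (x t) ≤ x (t + 1)
  mono : StrictMono x

/-- `π n` parametrises the curve `n`; curves from different blocks share exactly one vertex. -/
def IsGluing {W : Type*} (x : ℕ → ℤ) (π : ℕ → ℤ → W) : Prop :=
  ∀ n i m j, π n i = π m j ↔
    (n = m ∧ i = j) ∨ (Nat.sqrt n ≠ Nat.sqrt m ∧ i = pos x n m ∧ j = pos x m n)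

/-- A double ray `c` with word `ε` in the union of the curves: the `i`-th edge of `c` is traversed
on the curve `n i`, from position `y i` in direction `σ i`. -/
structure IsTrace {W : Type*} (ε : ℤ → Bool) (π : ℕ → ℤ → W) (c : ℤ → W) (n : ℤ → ℕ)
    (y σ : ℤ → ℤ) : Prop where
  dir : ∀ i, σ i = 1 ∨ σ i = -1
  letter_eq : ∀ i, ε i = letter ε (y i) (σ i)
  source : ∀ i, c i = π (n i) (y i)
  target : ∀ i, c (i + 1) = π (n i) (y i + σ i)
  inj : Function.Injective c

/-- The trace does not change curves between its `i`-th and its next edge. -/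
def Stays (n : ℤ → ℕ) (y σ : ℤ → ℤ) (i : ℤ) : Prop :=
  n (i + 1) = n i ∧ y (i + 1) = y i + σ i ∧ σ (i + 1) = σ i

theorem Stays.linear {n : ℤ → ℕ} {y σ : ℤ → ℤ} {i : ℤ} {k : ℕ}
    (h : ∀ r : ℕ, r < k → Stays n y σ (i + r)) :
    n (i + k) = n i ∧ y (i + k) = y i + k * σ i ∧ σ (i + k) = σ i := by
  induction k with
  | zero => simp
  | succ k ih =>
    obtain ⟨h1, h2, h3⟩ := ih fun r hr => h r (by omega)
    obtain ⟨g1, g2, g3⟩ := h k (by omega)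
    push_cast
    rw [← add_assoc, g1, g2, g3, h1, h2, h3]
    exact ⟨rfl, by ring, rfl⟩

/-! ### Traces at the crossings -/

section Crossing

variable {ε : ℤ → Bool} {F : ℤ → ℤ} {X : ℤ} {x : ℕ → ℤ}

theorem IsCrossingSeq.turn (hx : IsCrossingSeq ε F X x) (s : ℕ) : ε (x s - 1) ≠ ε (x s) := by
  rcases Nat.even_or_odd' s with ⟨t, rfl | rfl⟩
  · rw [(hx.source t).1, (hx.source t).2]; decide
  · rw [(hx.sink t).1, (hx.sink t).2]; decide

theorem IsCrossingSeq.letter_turn (hx : IsCrossingSeq ε F X x) (s : ℕ) {σ : ℤ}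
    (hσ : σ = 1 ∨ σ = -1) : letter ε (x s - σ) σ ≠ letter ε (x s) σ := by
  have := hx.turn s
  rcases hσ with rfl | rfl
  · simpa [letter] using this
  · simpa [letter] using this.symm

theorem IsCrossingSeq.le (hx : IsCrossingSeq ε F X x) (s : ℕ) : X ≤ x s :=
  hx.le_zero.trans (hx.mono.monotone (Nat.zero_le s))

theorem IsCrossingSeq.natCast_le (hx : IsCrossingSeq ε F X x) (hX : 0 ≤ X) (s : ℕ) :
    (s : ℤ) ≤ x s := by
  induction s with
  | zero => simpa using hX.trans hx.le_zero
  | succ s ih =>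
    have := hx.mono (Nat.lt_add_one s)
    push_cast; omega

/-- Distinct crossing positions are far apart. -/
theorem IsCrossingSeq.gap {D : ℤ} (hx : IsCrossingSeq ε F X x) (hF : ∀ z, z + D ≤ F z) {s t : ℕ}
    (h : s < t) : x s + D ≤ x t :=
  (hF _).trans ((hx.growth s).trans (hx.mono.monotone h))

theorem IsCrossingSeq.not_mem_of_near {D : ℤ} (hx : IsCrossingSeq ε F X x)
    (hF : ∀ z, z + D ≤ F z) (s : ℕ) {σ : ℤ} (hσ : σ = 1 ∨ σ = -1) {r : ℤ} (h0 : 0 < r)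
    (hr : r < D) : x s + r * σ ∉ Set.range x := by
  rintro ⟨t, ht⟩
  rcases lt_trichotomy s t with h | h | h
  · have := hx.gap hF h
    rcases hσ with rfl | rfl <;> omega
  · subst h
    rcases hσ with rfl | rfl <;> omega
  · have := hx.gap hF h
    rcases hσ with rfl | rfl <;> omega

variable {W : Type*} {π : ℕ → ℤ → W} {c : ℤ → W} {n : ℤ → ℕ} {y σ : ℤ → ℤ}

/-- Continuing on the same curve in the opposite direction is ruled out by injectivity, so the only
alternative to staying is a genuine crossing. -/
theorem IsTrace.switch (hc : IsTrace ε π c n y σ) (hπ : IsGluing x π) {i : ℤ}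
    (h : ¬ Stays n y σ i) : Nat.sqrt (n i) ≠ Nat.sqrt (n (i + 1)) ∧
      y i + σ i = pos x (n i) (n (i + 1)) ∧ y (i + 1) = pos x (n (i + 1)) (n i) := by
  have h1 := (hc.target i).symm.trans (hc.source (i + 1))
  rcases (hπ _ _ _ _).1 h1 with ⟨h2, h3⟩ | h2
  · exfalso
    refine h ⟨h2.symm, h3.symm, ?_⟩
    by_contra h4
    have h5 : y (i + 1) + σ (i + 1) = y i := by
      rcases hc.dir i with h6 | h6 <;> rcases hc.dir (i + 1) with h7 | h7 <;> omega
    have h6 := hc.target (i + 1)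
    rw [h5, ← h2, ← hc.source i] at h6
    have := hc.inj h6
    omega
  · exact h2

theorem IsTrace.switch_stage (hc : IsTrace ε π c n y σ) (hπ : IsGluing x π) {i : ℤ}
    (h : ¬ Stays n y σ i) : ∃ t, n i ≤ t ∧ n (i + 1) ≤ t ∧
      ((y i + σ i = x (2 * t) ∧ y (i + 1) = x (2 * t + 1)) ∨
        (y i + σ i = x (2 * t + 1) ∧ y (i + 1) = x (2 * t))) := by
  obtain ⟨h1, h2, h3⟩ := hc.switch hπ h
  rw [h2, h3]
  exact pos_cases x fun h => h1 (by rw [h])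

/-- A double ray that changes curves has no turn there. -/
theorem IsTrace.switch_letter (hc : IsTrace ε π c n y σ) (hπ : IsGluing x π)
    (hx : IsCrossingSeq ε F X x) {i : ℤ} (h : ¬ Stays n y σ i) : ε i = ε (i + 1) := by
  -- One of the two positions is a source and the other a sink: the trace traverses both edges along
  -- their arcs or both against them.
  obtain ⟨t, -, -, h | h⟩ := hc.switch_stage hπ h
  all_goals
    rw [hc.letter_eq i, hc.letter_eq (i + 1), eq_sub_of_add_eq h.1, h.2]
    have := hx.source t
    have := hx.sink t
    rcases hc.dir i with h1 | h1 <;> rcases hc.dir (i + 1) with h2 | h2 <;>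
      simp_all [letter]

theorem IsTrace.stays_of_not_mem (hc : IsTrace ε π c n y σ) (hπ : IsGluing x π) {i : ℤ}
    (h : y i + σ i ∉ Set.range x) : Stays n y σ i := by
  by_contra h1
  exact h ((hc.switch hπ h1).2.1 ▸ pos_mem x _ _)

theorem IsTrace.switch_mem (hc : IsTrace ε π c n y σ) (hπ : IsGluing x π) {i : ℤ}
    (h : ¬ Stays n y σ i) : ∃ s, y (i + 1) = x s := by
  obtain ⟨s, hs⟩ := (hc.switch hπ h).2.2 ▸ pos_mem x (n (i + 1)) (n i)
  exact ⟨s, hs.symm⟩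

theorem IsTrace.stays_of_forall_not_mem (hc : IsTrace ε π c n y σ) (hπ : IsGluing x π) {i : ℤ}
    {k : ℕ} (h : ∀ r : ℕ, r < k → y i + (r + 1) * σ i ∉ Set.range x) :
    ∀ r : ℕ, r < k → Stays n y σ (i + r) := by
  intro r
  induction r using Nat.strong_induction_on with
  | _ r ih =>
    intro hr
    obtain ⟨-, h2, h3⟩ := Stays.linear (i := i) (k := r) fun s hs => ih s hs (by omega)
    apply hc.stays_of_not_mem hπ
    rw [h2, h3]
    have := h r hr
    rwa [show y i + (r + 1) * σ i = y i + r * σ i + σ i by ring] at this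

/-- A trace that never changes curves covers a curve. -/
theorem IsTrace.cover_of_stays (hc : IsTrace ε π c n y σ) (h : ∀ i, Stays n y σ i) :
    ∃ m, ∀ z, π m z ∈ Set.range c := by
  have key : ∀ i, n i = n 0 ∧ y i = y 0 + i * σ 0 ∧ σ i = σ 0 := by
    intro i
    obtain ⟨k, rfl | rfl⟩ := i.eq_nat_or_neg
    · simpa using Stays.linear (i := 0) (k := k) fun r _ => h _
    · obtain ⟨h1, h2, h3⟩ := Stays.linear (i := -(k : ℤ)) (k := k) fun r _ => h _
      simp only [neg_add_cancel] at h1 h2 h3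
      refine ⟨h1.symm, ?_, h3.symm⟩
      rw [h2, h3]; ring
  refine ⟨n 0, fun z => ⟨(z - y 0) * σ 0, ?_⟩⟩
  rw [hc.source, (key _).1, (key _).2.1]
  congr 1
  rcases hc.dir 0 with h | h <;> rw [h] <;> ring

/-- The double ray `c` covers a curve, or both outward tails at the crossing of two curves. -/
def Covers (x : ℕ → ℤ) (π : ℕ → ℤ → W) (c : ℤ → W) : Prop :=
  (∃ m, ∀ z, π m z ∈ Set.range c) ∨
    ∃ a b, Nat.sqrt a ≠ Nat.sqrt b ∧ (∀ z, pos x a b ≤ z → π a z ∈ Set.range c) ∧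
      ∀ z, pos x b a ≤ z → π b z ∈ Set.range c

end Crossing

/-! ### Both tails are eventually periodic -/

section Periodic

variable {ε : ℤ → Bool} {F : ℤ → ℤ} {X : ℤ} {x : ℕ → ℤ}
variable {W : Type*} {π : ℕ → ℤ → W} {c : ℤ → W} {n : ℤ → ℕ} {y σ : ℤ → ℤ}
variable {P K : ℕ}

theorem letter_periodic (hR : ∀ z : ℤ, K ≤ z → ε (z + P) = ε z) {z τ : ℤ} (hτ : τ = 1 ∨ τ = -1)
    (hz : K + P + 1 ≤ z) : letter ε (z + P * τ) τ = letter ε z τ := by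
  rcases hτ with rfl | rfl
  · simpa [letter] using hR z (by omega)
  · simp only [letter]
    have := hR (z - 1 - P) (by omega)
    rw [sub_add_cancel] at this
    rw [if_neg (by decide), if_neg (by decide), this]
    congr 2
    ring

/-- Curves are changed only near the origin of the double ray. -/
theorem IsTrace.switch_near (hc : IsTrace ε π c n y σ) (hπ : IsGluing x π)
    (hx : IsCrossingSeq ε F X x) (hP : 0 < P) (hR : ∀ z : ℤ, K ≤ z → ε (z + P) = ε z)
    (hL : ∀ z : ℤ, z + P ≤ -K → ε (z + P) = ε z) (hX : K + P + 2 ≤ X)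
    (hF : ∀ z, z + (P + 1) ≤ F z) {i : ℤ} (h : ¬ Stays n y σ i) : -(K + P) < i ∧ i < K := by
  by_contra hi
  have hper : ε (i + P) = ε i := by
    rcases le_or_gt (K : ℤ) i with h1 | h1
    · exact hR i h1
    · exact hL i (by omega)
  obtain ⟨s, hs⟩ := hc.switch_mem hπ h
  have hst := hc.stays_of_forall_not_mem hπ (i := i + 1) (k := P - 1) (by
    intro r hr
    rw [hs]
    exact hx.not_mem_of_near hF s (hc.dir _) (by omega) (by omega))
  obtain ⟨-, h2, h3⟩ := Stays.linear hst
  have h4 : i + 1 + ((P - 1 : ℕ) : ℤ) = i + P := by omega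
  rw [h4] at h2 h3
  have h5 := hc.letter_eq (i + P)
  have h7 := hc.dir (i + 1)
  -- Edge `i + P` of the trace lies one period beyond the edge by which the curve itself, followed
  -- in the same direction, would enter `x s`. That edge and the next one carry different letters,
  -- since `x s` is a turn, while `ε (i + P) = ε i = ε (i + 1)`.
  have h6 := letter_periodic hR (z := x s - σ (i + 1)) h7 (by
    have := hx.le s
    rcases h7 with h | h <;> omega)
  have h8 : y (i + P) = x s - σ (i + 1) + P * σ (i + 1) := by
    rw [h2, hs]
    push_cast [Nat.cast_sub (show 1 ≤ P from hP)]
    ring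
  rw [h3, h8, h6, hper] at h5
  have h9 := hc.letter_eq (i + 1)
  rw [hs] at h9
  exact hx.letter_turn s h7 (by rw [← h5, ← h9, hc.switch_letter hπ hx h])

theorem periodic_of_overlap (hR : ∀ z : ℤ, K ≤ z → ε (z + P) = ε z) {B : ℤ}
    (hB : ∀ z : ℤ, z + P ≤ B → ε (z + P) = ε z) (h : K + P ≤ B) (z : ℤ) : ε (z + P) = ε z := by
  rcases le_or_gt (K : ℤ) z with h1 | h1
  · exact hR z h1
  · exact hB z (by omega)

/-- All switches happen in a window shorter than the gap between crossings, so there is at most one.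
If either end then ran inwards, a periodic tail would be read along the inner side of a curve up to
a far-out crossing. It would overlap the periodic right tail and make all of `ε` periodic. -/
theorem IsTrace.covers_of_periodic (hc : IsTrace ε π c n y σ) (hπ : IsGluing x π)
    (hx : IsCrossingSeq ε F X x) (hP : 0 < P) (hR : ∀ z : ℤ, K ≤ z → ε (z + P) = ε z)
    (hL : ∀ z : ℤ, z + P ≤ -K → ε (z + P) = ε z) (hper : ∃ z, ε (z + P) ≠ ε z)
    (hX : 4 * K + 4 * P + 4 ≤ X) (hF : ∀ z, z + (2 * K + 2 * P + 2) ≤ F z) :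
    Covers x π c := by
  by_cases hall : ∀ i, Stays n y σ i
  · exact Or.inl (hc.cover_of_stays hall)
  push Not at hall
  obtain ⟨i, hi⟩ := hall
  right
  have near : ∀ j, ¬ Stays n y σ j → -(K + P : ℤ) < j ∧ j < K := fun j hj =>
    hc.switch_near hπ hx hP hR hL (by omega) (fun z => by have := hF z; omega) hj
  have fwd : ∀ j, ¬ Stays n y σ j → ∀ j', j < j' → Stays n y σ j' := by
    intro j hj j' hjj
    obtain ⟨s, hs⟩ := hc.switch_mem hπ hj
    by_contra hj'
    have h1 := near j hj
    have h2 := near j' hj'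
    have hst := hc.stays_of_forall_not_mem hπ (i := j + 1) (k := 2 * K + 2 * P + 1) (by
      intro r hr
      rw [hs]
      exact hx.not_mem_of_near hF s (hc.dir _) (by omega) (by omega))
    refine hj' ?_
    have := hst (j' - (j + 1)).toNat (by omega)
    rwa [show j + 1 + ((j' - (j + 1)).toNat : ℤ) = j' by omega] at this
  have hfuture : ∀ j, i < j → Stays n y σ j := fwd i hi
  have hpast : ∀ j, j < i → Stays n y σ j := fun j hj => by
    by_contra h
    exact hi (fwd j h i hj)
  have hni := near i hi
  obtain ⟨hs1, hs2, hs3⟩ := hc.switch hπ hi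
  set a := pos x (n i) (n (i + 1)) with ha
  set b := pos x (n (i + 1)) (n i) with hb
  have haX : X ≤ a := by
    obtain ⟨s, hs⟩ := pos_mem x (n i) (n (i + 1))
    rw [ha, ← hs]; exact hx.le s
  have hbX : X ≤ b := by
    obtain ⟨s, hs⟩ := pos_mem x (n (i + 1)) (n i)
    rw [hb, ← hs]; exact hx.le s
  have hf : ∀ k : ℕ, n (i + 1 + k) = n (i + 1) ∧ y (i + 1 + k) = b + k * σ (i + 1) ∧
      σ (i + 1 + k) = σ (i + 1) := fun k => by
    rw [← hs3]; exact Stays.linear fun r _ => hfuture _ (by omega)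
  have hp : ∀ k : ℕ, n (i - k) = n i ∧ y (i - k) = a - (k + 1) * σ i ∧ σ (i - k) = σ i := by
    intro k
    obtain ⟨h1, h2, h3⟩ := Stays.linear (n := n) (y := y) (σ := σ) (i := i - k) (k := k)
      fun r hr => hpast _ (by omega)
    rw [sub_add_cancel] at h1 h2 h3
    refine ⟨h1.symm, ?_, h3.symm⟩
    rw [← hs2, h2, h3]; ring
  -- Otherwise the right tail of `ε` is read backwards along the curve, inwards from `b`.
  have hσf : σ (i + 1) = 1 := by
    rcases hc.dir (i + 1) with h | h
    · exact h
    exfalso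
    have hw : ∀ z, z ≤ b - 1 → ε (i + b - z) = !ε z := by
      intro z hz
      obtain ⟨-, h2, h3⟩ := hf (b - 1 - z).toNat
      have h1 := hc.letter_eq (i + 1 + (b - 1 - z).toNat)
      rw [h2, h3, h, show i + 1 + ((b - 1 - z).toNat : ℤ) = i + b - z by omega,
        show b + ((b - 1 - z).toNat : ℤ) * -1 = z + 1 by omega] at h1
      simpa [letter] using h1
    obtain ⟨z, hz⟩ := hper
    refine hz (periodic_of_overlap hR (B := i + b - K) (fun z hz => ?_) (by omega) z)
    have h1 := hw z (by omega)
    have h2 := hw (z + P) (by omega)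
    have h3 := hR (i + b - (z + P)) (by omega)
    rw [show i + b - (z + P) + P = i + b - z by ring, h1, h2] at h3
    simpa using h3.symm
  -- Otherwise the left tail of `ε` is a translate of the part of the curve below `a`.
  have hσp : σ i = -1 := by
    rcases hc.dir i with h | h
    swap
    · exact h
    exfalso
    have hw : ∀ z, z ≤ a - 1 → ε (z - a + i + 1) = ε z := by
      intro z hz
      obtain ⟨-, h2, h3⟩ := hp (a - 1 - z).toNat
      have h1 := hc.letter_eq (i - (a - 1 - z).toNat)
      rw [h2, h3, h, show i - ((a - 1 - z).toNat : ℤ) = z - a + i + 1 by omega,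
        show a - (((a - 1 - z).toNat : ℤ) + 1) * 1 = z by omega] at h1
      simpa [letter] using h1
    obtain ⟨z, hz⟩ := hper
    refine hz (periodic_of_overlap hR (B := a - i - 1 - K - P) (fun z hz => ?_) (by omega) z)
    have h1 := hw z (by omega)
    have h2 := hw (z + P) (by omega)
    have h3 := hL (z - a + i + 1) (by omega)
    rw [← h1, ← h2, ← h3]
    congr 1
    ring
  refine ⟨n i, n (i + 1), hs1, fun z hz => ?_, fun z hz => ?_⟩
  · rcases eq_or_lt_of_le hz with hz | hz
    · refine ⟨i + 1, ?_⟩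
      rw [hc.target, hs2, ← hz]
    · refine ⟨i - (z - a - 1).toNat, ?_⟩
      obtain ⟨h1, h2, -⟩ := hp (z - a - 1).toNat
      rw [hc.source, h1, h2, hσp]
      congr 1
      omega
  · refine ⟨i + 1 + (z - b).toNat, ?_⟩
    obtain ⟨h1, h2, -⟩ := hf (z - b).toNat
    rw [hc.source, h1, h2, hσf]
    congr 1
    omega

end Periodic

/-! ### The right tail is not eventually periodic -/

section Aperiodic

variable {ε : ℤ → Bool} {F : ℤ → ℤ} {X : ℤ} {x : ℕ → ℤ}
variable {W : Type*} {π : ℕ → ℤ → W} {c : ℤ → W} {n : ℤ → ℕ} {y σ : ℤ → ℤ}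

/-- The word `ε` is not eventually periodic to the right. -/
def AperiodicRight (ε : ℤ → Bool) : Prop := ∀ P : ℕ, 0 < P → ∀ K : ℤ, ∃ z, K ≤ z ∧ ε (z + P) ≠ ε z

theorem AperiodicRight.exists_ne (h : AperiodicRight ε) {δ : ℤ} (hδ : δ ≠ 0) (K : ℤ) :
    ∃ z, K ≤ z ∧ ε (z + δ) ≠ ε z := by
  obtain ⟨k, rfl | rfl⟩ := δ.eq_nat_or_neg
  · exact h k (by omega) K
  · obtain ⟨z, hz, hne⟩ := h k (by omega) K
    exact ⟨z + k, by omega, by simpa using hne.symm⟩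

/-- Shifts of bounded size are told apart from `ε` on a bounded interval. -/
theorem AperiodicRight.exists_bound (h : AperiodicRight ε) : ∃ D : ℕ → ℤ, ∀ (N : ℕ) (δ : ℤ),
    δ ≠ 0 → |δ| ≤ N → ∃ z : ℤ, N ≤ z ∧ z ≤ D N ∧ ε (z + δ) ≠ ε z := by
  have : ∀ N : ℕ, ∃ D : ℤ, ∀ δ : ℤ,
      δ ≠ 0 → |δ| ≤ N → ∃ z : ℤ, N ≤ z ∧ z ≤ D ∧ ε (z + δ) ≠ ε z := by
    intro N
    choose! g hg using fun (δ : ℤ) (hδ : δ ≠ 0) => h.exists_ne hδ N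
    obtain ⟨D, hD⟩ := ((Set.finite_Icc (-(N : ℤ)) N).image g).bddAbove
    refine ⟨D, fun δ h0 hN => ⟨g δ, (hg δ h0).1, hD ⟨δ, ?_, rfl⟩, (hg δ h0).2⟩⟩
    exact abs_le.1 hN
  choose D hD using this
  exact ⟨D, hD⟩

/-- A reflection that preserves a sufficiently long left tail of `ε` preserves `ε`. -/
theorem AperiodicRight.exists_reflection_bound (h : AperiodicRight ε) : ∃ X : ℤ, ∀ c : ℤ,
    (∀ z, z ≤ X → ε (c - z) = !ε z) → ∀ z, ε (c - z) = !ε z := by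
  by_cases h0 : ∃ c X : ℤ, ∀ z, z ≤ X → ε (c - z) = !ε z
  · obtain ⟨c, X, hc⟩ := h0
    -- Two such reflections compose to a translation preserving a right tail, which aperiodicity
    -- allows only if it is trivial.
    have huniq : ∀ c' X' : ℤ, (∀ z, z ≤ X' → ε (c' - z) = !ε z) → c' = c := by
      intro c' X' hc'
      by_contra hne
      obtain ⟨z, hz, hz'⟩ := h.exists_ne (sub_ne_zero.2 hne) (c - min X X')
      apply hz'
      have h1 := hc (c - z) (by omega)
      have h2 := hc' (c - z) (by omega)
      rw [← h1, sub_sub_cancel] at h2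
      rw [← h2]
      congr 1
      ring
    by_cases hf : ∀ z, ε (c - z) = !ε z
    · exact ⟨X, fun c' hc' => huniq c' X hc' ▸ hf⟩
    · push Not at hf
      obtain ⟨z, hz⟩ := hf
      -- The only candidate `c` fails at `z`, so with the bound `z` no reflection satisfies the
      -- premise.
      refine ⟨z, fun c' hc' => absurd ?_ hz⟩
      have := hc' z le_rfl
      rwa [huniq c' z hc'] at this
  · exact ⟨0, fun c hc => absurd ⟨c, 0, hc⟩ h0⟩

/-- A trace in phase with the curve it follows cannot leave it. -/
theorem IsTrace.stays_of_phase (hc : IsTrace ε π c n y σ) (hπ : IsGluing x π)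
    (hx : IsCrossingSeq ε F X x) {i : ℤ} (hy : y i = i) (hσ : σ i = 1) (k : ℕ) :
    Stays n y σ (i + k) := by
  induction k using Nat.strong_induction_on with
  | _ k ih =>
    obtain ⟨-, h2, h3⟩ := Stays.linear ih
    by_contra hs
    have h4 := hc.switch_letter hπ hx hs
    obtain ⟨s, hs'⟩ : ∃ s, y (i + k) + σ (i + k) = x s := by
      obtain ⟨t, -, -, h | h⟩ := hc.switch_stage hπ hs <;> exact ⟨_, h.1⟩
    rw [h2, h3, hy, hσ, mul_one] at hs'
    apply hx.turn s
    rw [← hs', h4.symm, add_sub_cancel_right]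

/-- By injectivity the trace must leave a finite box of curves and positions, and it does so along a
curve. Leaving downwards, it meets no further crossing. Leaving upwards, it enters a gap long enough
to detect any phase shift; with no shift, it never switches again. -/
theorem IsTrace.switch_bddAbove (hc : IsTrace ε π c n y σ) (hπ : IsGluing x π)
    (hx : IsCrossingSeq ε F X x) (hX : 1 ≤ X) {D : ℕ → ℤ} (hD : ∀ (N : ℕ) (δ : ℤ),
      δ ≠ 0 → |δ| ≤ N → ∃ z : ℤ, N ≤ z ∧ z ≤ D N ∧ ε (z + δ) ≠ ε z)
    (hF : ∀ z, z + 2 ≤ F z) (hFD : ∀ z, D ((z + 1) * (z + 1) + 2 * z + 1).toNat + 1 ≤ F z) :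
    ∃ B, ∀ i, ¬ Stays n y σ i → i ≤ B := by
  by_contra hunb
  push Not at hunb
  obtain ⟨i₀, hi₀, -⟩ := hunb 0
  obtain ⟨s₀, hs₀⟩ := hc.switch_mem hπ hi₀
  set j := i₀ + 1 with hj
  -- Chosen so that the box below contains the starting point and `|j| ≤ M`.
  set t := j.natAbs + n j + (y j).toNat with ht
  set M := x (2 * t + 1) with hM
  have htM : (t : ℤ) ≤ M := by
    have := hx.natCast_le (by omega) (2 * t + 1)
    push_cast at this; omega
  set box : Finset (ℕ × ℤ) := Finset.range (t + 1) ×ˢ Finset.Icc 0 M with hbox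
  have mem_box : ∀ p : ℕ × ℤ, p ∈ box ↔ p.1 ≤ t ∧ 0 ≤ p.2 ∧ p.2 ≤ M := fun p => by
    simp [hbox]
  have hcard : (box.card : ℤ) ≤ (M + 1) * (M + 1) := by
    rw [hbox, Finset.card_product, Finset.card_range, Int.card_Icc]
    push_cast
    rw [Int.toNat_of_nonneg (by omega), sub_zero]
    exact mul_le_mul_of_nonneg_right (by omega) (by omega)
  have hexit : ∃ r : ℕ, r ≤ box.card ∧ (n (j + r), y (j + r)) ∉ box := by
    by_contra hin
    push Not at hin
    have := Finset.card_le_card_of_injOn (s := Finset.range (box.card + 1)) (t := box)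
      (fun r : ℕ => (n (j + r), y (j + r)))
      (fun r hr => hin r (by simpa using hr)) (by
        intro r _ r' _ hrr
        simp only [Prod.mk.injEq] at hrr
        have h1 : c (j + r) = c (j + r') := by rw [hc.source, hc.source, hrr.1, hrr.2]
        have := hc.inj h1
        omega)
    simp at this
  classical
  obtain ⟨hrcard, hr⟩ := Nat.find_spec hexit
  have hmin : ∀ r' < Nat.find hexit, (n (j + r'), y (j + r')) ∈ box := by
    intro r' hr'
    by_contra h
    exact Nat.find_min hexit hr' ⟨by omega, h⟩
  set r := Nat.find hexit with hrdef
  have hr0 : r ≠ 0 := by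
    intro h0
    rw [h0, mem_box] at hr
    apply hr
    have := hx.le s₀
    simp only [Nat.cast_zero, add_zero]
    omega
  obtain ⟨i, hi⟩ : ∃ i, i = j + ((r - 1 : ℕ) : ℤ) := ⟨_, rfl⟩
  have hin := hmin (r - 1) (by omega)
  rw [← hi, mem_box] at hin
  rw [show j + (r : ℤ) = i + 1 by omega, mem_box] at hr
  obtain ⟨hin1, hin2, hin3⟩ := hin
  simp only at hin1 hin2 hin3 hr
  have hnext : M + 2 ≤ x (2 * t + 2) := (hF M).trans (hx.growth (2 * t + 1))
  have hout : ∀ s, M < x s → M + 2 ≤ x s := fun s hs =>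
    hnext.trans (hx.mono.monotone (by
      have := hx.mono.lt_iff_lt.1 hs
      omega))
  -- A crossing reached from inside the box has stage at most `t`, so both its curves and both its
  -- positions lie in the box.
  have hst : Stays n y σ i := by
    by_contra hst
    have hdir := hc.dir i
    obtain ⟨t', h1, h2, h3⟩ := hc.switch_stage hπ hst
    have key : x (2 * t' + 1) ≤ M := by
      have h4 : ∀ s, y i + σ i = x s → s ≤ 2 * t + 1 := fun s hs => by
        by_contra hlt
        have := hout s (hx.mono (show 2 * t + 1 < s by omega))
        omega
      apply hx.mono.monotone
      rcases h3 with h3 | h3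
      · have := h4 _ h3.1; omega
      · exact h4 _ h3.1
    have h4 : t' ≤ t := by
      have := hx.mono.le_iff_le.1 key
      omega
    have h5 := hx.mono (show 2 * t' < 2 * t' + 1 by omega)
    have h6 := hx.le (2 * t')
    apply hr
    rcases h3 with h3 | h3 <;> omega
  obtain ⟨g1, g2, g3⟩ := hst
  rw [g1, g2] at hr
  rcases hc.dir i with hσ | hσ
  · have hy : y i = M := by omega
    have hyi : y (i + 1) = M + 1 := by omega
    have hσi : σ (i + 1) = 1 := by omega
    by_cases hδ : i = M
    · obtain ⟨i', hi', hlt⟩ := hunb (i + 1)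
      refine hi' ?_
      have := hc.stays_of_phase hπ hx (i := i + 1) (by omega) hσi (i' - (i + 1)).toNat
      rwa [show i + 1 + ((i' - (i + 1)).toNat : ℤ) = i' by omega] at this
    -- The shift `i - M` is bounded by the box size plus `|j|` and `M`, hence in terms of `M` alone;
    -- the gap after `M` was chosen for that bound.
    · have hM0 : 0 ≤ (M + 1) * (M + 1) := mul_nonneg (by omega) (by omega)
      obtain ⟨z, hz1, hz2, hz3⟩ := hD ((M + 1) * (M + 1) + 2 * M + 1).toNat (i - M) (by omega)
        (by rw [Int.toNat_of_nonneg (by omega), abs_le]; omega)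
      rw [Int.toNat_of_nonneg (by omega)] at hz1
      have hz4 : z + 1 ≤ x (2 * t + 2) := by
        have := (hFD M).trans (hx.growth (2 * t + 1))
        have h2 : x (2 * t + 1 + 1) = x (2 * t + 2) := rfl
        omega
      have hrun := hc.stays_of_forall_not_mem hπ (i := i + 1) (k := (z - (M + 1)).toNat) (by
        rintro q hq ⟨s, hs⟩
        rw [hyi, hσi, mul_one] at hs
        have h1 := hx.mono.lt_iff_lt.1 (show x (2 * t + 1) < x s by omega)
        have h2 := hx.mono.lt_iff_lt.1 (show x s < x (2 * t + 2) by omega)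
        omega)
      obtain ⟨-, h2, h3⟩ := Stays.linear hrun
      have h4 := hc.letter_eq (i + 1 + (z - (M + 1)).toNat)
      rw [h2, h3, hσi, hyi] at h4
      apply hz3
      rw [show i + 1 + ((z - (M + 1)).toNat : ℤ) = z + (i - M) by omega,
        show M + 1 + ((z - (M + 1)).toNat : ℤ) * 1 = z by omega] at h4
      simpa [letter] using h4
  · have hyi : y (i + 1) = -1 := by omega
    have hσi : σ (i + 1) = -1 := by omega
    obtain ⟨i', hi', hlt⟩ := hunb (i + 1)
    refine hi' ?_
    have := hc.stays_of_forall_not_mem hπ (i := i + 1) (k := (i' - (i + 1)).toNat + 1) (by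
      rintro q hq ⟨s, hs⟩
      have := hx.le s
      rw [hyi, hσi] at hs
      omega) (i' - (i + 1)).toNat (by omega)
    rwa [show i + 1 + ((i' - (i + 1)).toNat : ℤ) = i' by omega] at this

/-- After a last switch the trace reads a translate or a reflection of `ε` forever. Aperiodicity
makes the translation trivial, and the choice of `X` extends the reflection to all of `ε`. Either
way the turn at `x s` becomes a turn of `ε` at `i + 1`, where a switch allows none. -/
theorem IsTrace.covers_of_aperiodic (hE : AperiodicRight ε) (hc : IsTrace ε π c n y σ)
    (hπ : IsGluing x π) (hx : IsCrossingSeq ε F X x) (hX : 1 ≤ X)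
    (hrefl : ∀ c : ℤ, (∀ z, z < X → ε (c - z) = !ε z) → ∀ z, ε (c - z) = !ε z)
    {D : ℕ → ℤ} (hD : ∀ (N : ℕ) (δ : ℤ),
      δ ≠ 0 → |δ| ≤ N → ∃ z : ℤ, N ≤ z ∧ z ≤ D N ∧ ε (z + δ) ≠ ε z)
    (hF : ∀ z, z + 2 ≤ F z) (hFD : ∀ z, D ((z + 1) * (z + 1) + 2 * z + 1).toNat + 1 ≤ F z) :
    Covers x π c := by
  refine Or.inl ?_
  by_cases hall : ∀ i, Stays n y σ i
  · exact hc.cover_of_stays hall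
  exfalso
  push Not at hall
  obtain ⟨i, hi, hmax⟩ := Int.exists_greatest_of_bdd
    (hc.switch_bddAbove hπ hx hX hD hF hFD) hall
  obtain ⟨s, hs⟩ := hc.switch_mem hπ hi
  have hlin : ∀ k : ℕ, y (i + 1 + k) = x s + k * σ (i + 1) ∧ σ (i + 1 + k) = σ (i + 1) := by
    intro k
    obtain ⟨-, h2, h3⟩ := Stays.linear (n := n) (y := y) (σ := σ) (i := i + 1) (k := k)
      fun r _ => by
        by_contra h
        have := hmax _ h
        omega
    exact ⟨by rw [h2, hs], h3⟩
  have hlet := hc.switch_letter hπ hx hi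
  have hturn := hx.turn s
  have hsX := hx.le s
  rcases hc.dir (i + 1) with hσ | hσ
  · have hw : ∀ z, x s ≤ z → ε (z + (i + 1 - x s)) = ε z := by
      intro z hz
      obtain ⟨h2, h3⟩ := hlin (z - x s).toNat
      have h1 := hc.letter_eq (i + 1 + (z - x s).toNat)
      rw [h2, h3, hσ, show i + 1 + ((z - x s).toNat : ℤ) = z + (i + 1 - x s) by omega,
        show x s + ((z - x s).toNat : ℤ) * 1 = z by omega] at h1
      simpa [letter] using h1
    have hδ : i + 1 = x s := by
      by_contra hne
      obtain ⟨z, hz, hz'⟩ := hE.exists_ne (sub_ne_zero.2 hne) (x s)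
      exact hz' (hw z hz)
    rw [← hδ, add_sub_cancel_right] at hturn
    exact hturn hlet
  · have hw : ∀ z, z ≤ x s - 1 → ε (i + x s - z) = !ε z := by
      intro z hz
      obtain ⟨h2, h3⟩ := hlin (x s - 1 - z).toNat
      have h1 := hc.letter_eq (i + 1 + (x s - 1 - z).toNat)
      rw [h2, h3, hσ, show i + 1 + ((x s - 1 - z).toNat : ℤ) = i + x s - z by omega,
        show x s + ((x s - 1 - z).toNat : ℤ) * -1 = z + 1 by omega] at h1
      simpa [letter] using h1
    have hfull := hrefl (i + x s) fun z hz => hw z (by omega)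
    have h1 := hfull (x s)
    have h2 := hfull (x s - 1)
    rw [show i + x s - x s = i by ring] at h1
    rw [show i + x s - (x s - 1) = i + 1 by ring] at h2
    rw [h1, h2] at hlet
    exact hturn (by simpa using hlet.symm)

end Aperiodic

/-! ### Existence of crossing positions and of the glued digraph -/

/-- Both letters occur arbitrarily far to the right. -/
def Oscillates (ε : ℤ → Bool) : Prop := ∀ (b : Bool) (K : ℤ), ∃ z, K ≤ z ∧ ε z = b

theorem eventually_const_of_not_oscillates {ε : ℤ → Bool} (h : ¬ Oscillates ε) :
    ∃ (b : Bool) (K : ℤ), ∀ z, K ≤ z → ε z = b := by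
  unfold Oscillates at h
  push Not at h
  obtain ⟨b, K, h⟩ := h
  exact ⟨!b, K, fun z hz => Bool.eq_not_iff.2 (h z hz)⟩

theorem AperiodicRight.oscillates {ε : ℤ → Bool} (h : AperiodicRight ε) : Oscillates ε := by
  by_contra h1
  obtain ⟨b, K, hb⟩ := eventually_const_of_not_oscillates h1
  obtain ⟨z, hz, hne⟩ := h 1 one_pos K
  exact hne (by rw [hb z hz, hb _ (by omega)])

theorem Oscillates.exists_turn {ε : ℤ → Bool} (h : Oscillates ε) (b : Bool) (K : ℤ) :
    ∃ z, K ≤ z ∧ ε (z - 1) = (!b) ∧ ε z = b := by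
  obtain ⟨y, hy, hyb⟩ := h (!b) K
  -- The first occurrence of `b` after an occurrence of `!b` is a turn of the required kind.
  obtain ⟨z, ⟨hz, hzb⟩, hmin⟩ := Int.exists_least_of_bdd (P := fun z => y ≤ z ∧ ε z = b)
    ⟨y, fun z hz => hz.1⟩ (h b y)
  have hne : y ≠ z := by rintro rfl; simp [hzb] at hyb
  refine ⟨z, by omega, ?_, hzb⟩
  by_contra h1
  have := hmin (z - 1) ⟨by omega, by simpa using h1⟩
  omega

theorem Oscillates.exists_crossingSeq {ε : ℤ → Bool} (h : Oscillates ε) (F : ℤ → ℤ) (X : ℤ) :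
    ∃ x, IsCrossingSeq ε F X x := by
  choose next h1 h2 h3 using h.exists_turn
  let x : ℕ → ℤ := fun k => Nat.rec (next true X)
    (fun k v => next (decide ((k + 1) % 2 = 0)) (max (F v) (v + 1))) k
  have hs : ∀ k, x (k + 1) = next (decide ((k + 1) % 2 = 0)) (max (F (x k)) (x k + 1)) :=
    fun _ => rfl
  have hb : ∀ k, ε (x k - 1) = (!decide (k % 2 = 0)) ∧ ε (x k) = decide (k % 2 = 0) := by
    rintro (_ | k)
    · exact ⟨h2 true X, h3 true X⟩
    · rw [hs]; exact ⟨h2 _ _, h3 _ _⟩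
  refine ⟨x, fun t => ?_, fun t => ?_, h1 _ _, fun t => ?_, strictMono_nat_of_lt_succ fun t => ?_⟩
  · simpa using hb (2 * t)
  · have := hb (2 * t + 1)
    rwa [show decide ((2 * t + 1) % 2 = 0) = false by simp] at this
  · exact (le_max_left _ _).trans (hs t ▸ h1 _ _)
  · exact Int.lt_iff_add_one_le.2 ((le_max_right _ _).trans (hs t ▸ h1 _ _))

/-- Identify the crossing positions in a disjoint union of lines. By `pos_inj` each position is used
by at most one crossing, so classes have at most two elements and transitivity holds. -/
theorem exists_gluing {x : ℕ → ℤ} (hx : StrictMono x) :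
    ∃ (W : Type w) (π : ℕ → ℤ → W), IsGluing x π := by
  let r : Setoid (ℕ × ℤ) :=
    { r := fun a b => (a.1 = b.1 ∧ a.2 = b.2) ∨
        (Nat.sqrt a.1 ≠ Nat.sqrt b.1 ∧ a.2 = pos x a.1 b.1 ∧ b.2 = pos x b.1 a.1)
      iseqv :=
        { refl := fun a => Or.inl ⟨rfl, rfl⟩
          symm := by
            rintro a b (⟨h1, h2⟩ | ⟨h1, h2, h3⟩)
            · exact Or.inl ⟨h1.symm, h2.symm⟩
            · exact Or.inr ⟨h1.symm, h3, h2⟩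
          trans := by
            rintro ⟨a, a'⟩ ⟨b, b'⟩ ⟨c, c'⟩ (⟨h1, h2⟩ | ⟨h1, h2, h3⟩) (⟨g1, g2⟩ | ⟨g1, g2, g3⟩) <;>
              simp only at *
            · subst h1 h2 g1 g2; simp
            · subst h1 h2; exact Or.inr ⟨g1, g2, g3⟩
            · subst g1 g2; exact Or.inr ⟨h1, h2, h3⟩
            · have := pos_inj hx (h3.symm.trans g2)
              subst this
              exact Or.inl ⟨rfl, h2.trans g3.symm⟩ } }
  exact ⟨ULift.{w} (Quotient r), fun n i => ⟨Quotient.mk r (n, i)⟩, fun n i m j =>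
    (ULift.up_inj.trans Quotient.eq)⟩

/-! ### No infinite family of disjoint double rays -/

section Disjoint

variable {W : Type*} {x : ℕ → ℤ} {π : ℕ → ℤ → W}

theorem IsGluing.crossing (hπ : IsGluing x π) {n m : ℕ} (h : Nat.sqrt n ≠ Nat.sqrt m) :
    π n (pos x n m) = π m (pos x m n) :=
  (hπ _ _ _ _).2 (Or.inr ⟨h, rfl, rfl⟩)

/-- Farther back, the curve `b` crosses the curves of smaller index in decreasing order. -/
theorem pos_lt_pos (hx : StrictMono x) {k a b : ℕ} (hk : k < a) (ha : a < b) :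
    pos x b a < pos x b k := by
  unfold pos
  rw [if_neg (by omega), if_neg (by omega)]
  have := stage_lt_stage hk ha
  exact hx (by omega)

/-- All curves from `B` on cross the tail of `k` held by `c`. If `c'` covered outward tails of two
such curves `a < b`, the one on `b`, starting at its crossing with `a`, would contain the later
crossing with `k`. -/
theorem exists_small_index (hx : StrictMono x) (hπ : IsGluing x π) {c c' : ℤ → W} {k B : ℕ}
    {A : ℤ} (hk : ∀ z, A ≤ z → π k z ∈ Set.range c) (hB : ∀ m, B ≤ m → k < m ∧
      Nat.sqrt k ≠ Nat.sqrt m ∧ A ≤ pos x k m)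
    (hdisj : Disjoint (Set.range c) (Set.range c')) (hcov : Covers x π c') :
    ∃ m, m < B ∧ ∃ A', ∀ z, A' ≤ z → π m z ∈ Set.range c' := by
  have key : ∀ m, B ≤ m → π m (pos x m k) ∉ Set.range c' := fun m hm h => by
    obtain ⟨-, h2, h3⟩ := hB m hm
    refine Set.disjoint_left.1 hdisj (hk _ h3) ?_
    rwa [hπ.crossing h2]
  rcases hcov with ⟨m, hm⟩ | ⟨a, b, hab, ha, hb⟩
  · exact ⟨m, by by_contra h; exact key m (by omega) (hm _), 0, fun z _ => hm z⟩
  · rcases lt_or_ge a B with h1 | h1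
    · exact ⟨a, h1, _, ha⟩
    rcases lt_or_ge b B with h2 | h2
    · exact ⟨b, h2, _, hb⟩
    exfalso
    have hne : a ≠ b := fun h => hab (by rw [h])
    rcases lt_or_gt_of_ne hne with h | h
    · exact key b h2 (hb _ (pos_lt_pos hx (hB a h1).1 h).le)
    · exact key a h1 (ha _ (pos_lt_pos hx (hB b h2).1 h).le)

theorem not_pairwise_disjoint (hx : StrictMono x) (hx0 : ∀ s : ℕ, (s : ℤ) ≤ x s)
    (hπ : IsGluing x π) (c : ℕ → ℤ → W) (hcov : ∀ k, Covers x π (c k)) :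
    ¬ Pairwise fun i j => Disjoint (Set.range (c i)) (Set.range (c j)) := by
  intro hdisj
  obtain ⟨k, A, hk⟩ : ∃ k A, ∀ z, A ≤ z → π k z ∈ Set.range (c 0) := by
    rcases hcov 0 with ⟨m, hm⟩ | ⟨a, b, -, ha, -⟩
    · exact ⟨m, 0, fun z _ => hm z⟩
    · exact ⟨a, _, ha⟩
  -- The square puts later curves into later blocks than `k`; the second summand puts their
  -- crossings with `k` beyond `A`.
  let B := (k + 1) * (k + 1) + A.toNat
  have hB : ∀ m, B ≤ m → k < m ∧ Nat.sqrt k ≠ Nat.sqrt m ∧ A ≤ pos x k m := by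
    intro m hm
    have h1 : (k + 1) * (k + 1) ≤ m := (Nat.le_add_right _ _).trans hm
    have h2 : k + 1 ≤ Nat.sqrt m := Nat.le_sqrt.2 h1
    have h3 := Nat.sqrt_le_self k
    have h4 := Nat.sqrt_le_self m
    refine ⟨by omega, by omega, ?_⟩
    have h5 : A.toNat ≤ m := (Nat.le_add_left _ _).trans hm
    unfold pos
    rw [if_pos (by omega)]
    have h6 := le_stage_right k m
    have h7 := hx0 (2 * stage k m)
    push_cast at h7
    omega
  choose m hm A' hA' using fun j : ℕ =>
    exists_small_index hx hπ hk hB (hdisj (Nat.succ_ne_zero j).symm) (hcov (j + 1))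
  obtain ⟨i, j, hij, heq⟩ :=
    Finite.exists_ne_map_eq_of_infinite fun j => (⟨m j, hm j⟩ : Fin B)
  have heq : m i = m j := congrArg Fin.val heq
  refine Set.disjoint_left.1 (hdisj (show i + 1 ≠ j + 1 by omega))
    (hA' i _ (le_max_left (A' i) (A' j))) ?_
  rw [heq]
  exact hA' j _ (le_max_right _ _)

end Disjoint

/-! ### Non-ubiquity -/

/-- The union of the curves `π m`, oriented according to the word `ε`. -/
def gluedDigraph {W : Type*} (ε : ℤ → Bool) (π : ℕ → ℤ → W) : Digraph W where
  Adj v v' := ∃ m z, (ε z = true ∧ v = π m z ∧ v' = π m (z + 1)) ∨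
    (ε z = false ∧ v = π m (z + 1) ∧ v' = π m z)

/-- `f` identifies the double ray with word `ε` with `R`. -/
def IsWord {V : Type*} (ε : ℤ → Bool) (f : ℤ ≃ V) (R : Digraph V) : Prop :=
  ∀ i j, R.Adj (f i) (f j) ↔ (j = i + 1 ∧ ε i = true) ∨ (i = j + 1 ∧ ε j = false)

section Word

variable {V : Type u} {ε : ℤ → Bool} {f : ℤ ≃ V} {R : Digraph V}

theorem IsWord.exists_trace {W : Type*} (hf : IsWord ε f R) {π : ℕ → ℤ → W}
    (C : Digraph.Copy R (gluedDigraph ε π)) :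
    ∃ n y σ, IsTrace ε π (fun i => C.toFun (f i)) n y σ := by
  have : ∀ i, ∃ (n : ℕ) (y σ : ℤ), (σ = 1 ∨ σ = -1) ∧ ε i = letter ε y σ ∧
      C.toFun (f i) = π n y ∧ C.toFun (f (i + 1)) = π n (y + σ) := by
    intro i
    cases hi : ε i
    · obtain ⟨m, z, ⟨h1, h2, h3⟩ | ⟨h1, h2, h3⟩⟩ :=
        C.map_adj ((hf (i + 1) i).2 (Or.inr ⟨rfl, hi⟩))
      · exact ⟨m, z + 1, -1, Or.inr rfl, by simp [letter, h1], h3, by simpa using h2⟩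
      · exact ⟨m, z, 1, Or.inl rfl, by simp [letter, h1], h3, h2⟩
    · obtain ⟨m, z, ⟨h1, h2, h3⟩ | ⟨h1, h2, h3⟩⟩ :=
        C.map_adj ((hf i (i + 1)).2 (Or.inl ⟨rfl, hi⟩))
      · exact ⟨m, z, 1, Or.inl rfl, by simp [letter, h1], h2, h3⟩
      · exact ⟨m, z + 1, -1, Or.inr rfl, by simp [letter, h1], h2, by simpa using h3⟩
  choose n y σ h1 h2 h3 h4 using this
  exact ⟨n, y, σ, h1, h2, h3, h4, C.injective.comp f.injective⟩

theorem IsWord.not_isUbiquitous (hf : IsWord ε f R) {x : ℕ → ℤ} (hx : StrictMono x)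
    (hx0 : ∀ s : ℕ, (s : ℤ) ≤ x s)
    (hcov : ∀ (W : Type w) (π : ℕ → ℤ → W) (c : ℤ → W) (n : ℤ → ℕ) (y σ : ℤ → ℤ),
      IsGluing x π → IsTrace ε π c n y σ → Covers x π c) :
    ¬ Digraph.IsUbiquitous.{u, w} R := by
  intro hub
  obtain ⟨W, π, hπ⟩ := exists_gluing.{w} hx
  have hsame : ∀ {m i j}, π m i = π m j → i = j := fun {m i j} h => by
    rcases (hπ _ _ _ _).1 h with h | h
    · exact h.2
    · exact absurd rfl h.1
  obtain ⟨C, hC⟩ := hub W (gluedDigraph ε π) (by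
    rintro v ⟨m, z, ⟨-, rfl, h⟩ | ⟨-, rfl, h⟩⟩ <;> have := hsame h <;> omega) (by
    intro k
    -- The first `k` curves of block `k` serve as the `k` disjoint copies.
    refine ⟨fun a => ⟨fun v => π (k * k + a) (f.symm v), fun v v' h => ?_, fun v v' h => ?_⟩,
      fun a b hab => ?_⟩
    · exact f.symm.injective (hsame h)
    · obtain ⟨i, rfl⟩ := f.surjective v
      obtain ⟨j, rfl⟩ := f.surjective v'
      simp only [Equiv.symm_apply_apply]
      rcases (hf i j).1 h with ⟨rfl, h'⟩ | ⟨rfl, h'⟩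
      · exact ⟨_, i, Or.inl ⟨h', rfl, rfl⟩⟩
      · exact ⟨_, j, Or.inr ⟨h', rfl, rfl⟩⟩
    · refine Set.disjoint_left.2 ?_
      rintro _ ⟨v, rfl⟩ ⟨v', h⟩
      rcases (hπ (k * k + b) _ (k * k + a) _).1 h with ⟨h, -⟩ | ⟨h, -⟩
      · exact hab (Fin.ext (by omega))
      · rw [Nat.sqrt_add_eq _ (by omega), Nat.sqrt_add_eq _ (by omega)] at h
        exact h rfl)
  refine not_pairwise_disjoint hx hx0 hπ (fun k i => (C k).toFun (f i)) (fun k => ?_) ?_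
  · obtain ⟨n, y, σ, ht⟩ := hf.exists_trace (C k)
    exact hcov W π _ n y σ hπ ht
  · intro i j hij
    have h : Disjoint (Set.range (C i).toFun) (Set.range (C j).toFun) := hC hij
    rwa [← f.surjective.range_comp (C i).toFun, ← f.surjective.range_comp (C j).toFun] at h

theorem IsWord.not_isUbiquitous_of_aperiodicRight (hf : IsWord ε f R) (h : AperiodicRight ε) :
    ¬ Digraph.IsUbiquitous.{u, w} R := by
  obtain ⟨D, hD⟩ := h.exists_bound
  obtain ⟨X, hX⟩ := h.exists_reflection_bound
  obtain ⟨x, hx⟩ := h.oscillates.exists_crossingSeq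
    (fun z => max (z + 2) (D ((z + 1) * (z + 1) + 2 * z + 1).toNat + 1)) (max 1 (X + 1))
  refine hf.not_isUbiquitous hx.mono (hx.natCast_le (by omega)) fun W π c n y σ hπ hc => ?_
  exact hc.covers_of_aperiodic h hπ hx (le_max_left _ _)
    (fun c hc => hX c fun z hz => hc z (by omega)) hD (fun z => le_max_left _ _)
    (fun z => le_max_right _ _)

/-- The word of the reversed double ray. -/
def rev (ε : ℤ → Bool) : ℤ → Bool := fun z => !ε (-z - 1)

theorem rev_rev (ε : ℤ → Bool) : rev (rev ε) = ε := by
  funext z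
  simp [rev]

theorem IsWord.rev (hf : IsWord ε f R) : IsWord (rev ε) ((Equiv.neg ℤ).trans f) R := by
  intro i j
  have h := hf (-i) (-j)
  simp only [Equiv.trans_apply, Equiv.neg_apply, DoubleRay.rev, Bool.not_eq_true',
    Bool.not_eq_false']
  rw [h]
  constructor
  · rintro (⟨h1, h2⟩ | ⟨h1, h2⟩)
    · exact Or.inr ⟨by omega, by rwa [show -j - 1 = -i by omega]⟩
    · exact Or.inl ⟨by omega, by rwa [show -i - 1 = -j by omega]⟩
  · rintro (⟨h1, h2⟩ | ⟨h1, h2⟩)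
    · exact Or.inr ⟨by omega, by rwa [show -j = -i - 1 by omega]⟩
    · exact Or.inl ⟨by omega, by rwa [show -i = -j - 1 by omega]⟩

theorem exists_period_of_not_aperiodicRight (h : ¬ AperiodicRight ε) :
    ∃ P : ℕ, 0 < P ∧ ∃ K : ℤ, ∀ (k : ℕ) (z : ℤ), K ≤ z → ε (z + P * k) = ε z := by
  unfold AperiodicRight at h
  push Not at h
  obtain ⟨P, hP, K, h⟩ := h
  refine ⟨P, hP, K, fun k z hz => ?_⟩
  induction k with
  | zero => simp
  | succ k ih =>
    have h0 : (0 : ℤ) ≤ P * k := by positivity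
    rw [← ih, ← h (z + P * k) (by omega)]
    push_cast
    rw [mul_add, mul_one, add_assoc]

theorem IsWord.not_isUbiquitous_of_periodic_tails (hf : IsWord ε f R) (hosc : Oscillates ε)
    (hR : ¬ AperiodicRight ε) (hL : ¬ AperiodicRight (DoubleRay.rev ε))
    (hper : ∀ P : ℕ, 0 < P → ∃ z, ε (z + P) ≠ ε z) : ¬ Digraph.IsUbiquitous.{u, w} R := by
  obtain ⟨P, hP, K, hK⟩ := exists_period_of_not_aperiodicRight hR
  obtain ⟨Q, hQ, L, hL⟩ := exists_period_of_not_aperiodicRight hL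
  -- A common period for both tails.
  set T := P * Q with hT
  set M := K.natAbs + L.natAbs + 1 with hM
  have hright : ∀ z : ℤ, M ≤ z → ε (z + T) = ε z := fun z hz => by
    rw [← hK Q z (by omega), hT]
    push_cast; rfl
  have hleft : ∀ z : ℤ, z + T ≤ -M → ε (z + T) = ε z := fun z hz => by
    have h1 := hL P (-(z + T) - 1) (by omega)
    have h2 : -(z + (T : ℤ)) - 1 + Q * P = -z - 1 := by rw [hT]; push_cast; ring
    rw [h2] at h1
    simp only [DoubleRay.rev, Bool.not_inj_iff] at h1
    rw [show -(-z - 1) - 1 = z by ring, show -(-(z + T : ℤ) - 1) - 1 = z + T by ring] at h1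
    exact h1.symm
  obtain ⟨x, hx⟩ := hosc.exists_crossingSeq
    (fun z => z + (2 * M + 2 * T + 2)) (4 * M + 4 * T + 4)
  refine hf.not_isUbiquitous hx.mono (hx.natCast_le (by omega)) fun W π c n y σ hπ hc => ?_
  exact hc.covers_of_periodic hπ hx (Nat.mul_pos hP hQ) hright hleft
    (hper T (Nat.mul_pos hP hQ)) le_rfl fun z => le_rfl

/-- Crossings need infinitely many turns on one side. Reversing the ray if necessary puts these, or
an aperiodic tail, on the right. If neither side oscillates, all turns lie in a bounded interval. -/
theorem IsWord.not_isUbiquitous_of_infinite_turns (hf : IsWord ε f R)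
    (hper : ∀ P : ℕ, 0 < P → ∃ z, ε (z + P) ≠ ε z) (hturn : {z | ε (z - 1) ≠ ε z}.Infinite) :
    ¬ Digraph.IsUbiquitous.{u, w} R := by
  by_cases h1 : AperiodicRight ε
  · exact hf.not_isUbiquitous_of_aperiodicRight h1
  by_cases h2 : AperiodicRight (DoubleRay.rev ε)
  · exact hf.rev.not_isUbiquitous_of_aperiodicRight h2
  by_cases h3 : Oscillates ε
  · exact hf.not_isUbiquitous_of_periodic_tails h3 h1 h2 hper
  by_cases h4 : Oscillates (DoubleRay.rev ε)
  · refine hf.rev.not_isUbiquitous_of_periodic_tails h4 h2 (by rwa [rev_rev]) fun P hP => ?_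
    obtain ⟨z, hz⟩ := hper P hP
    refine ⟨-(z + P) - 1, ?_⟩
    simp only [DoubleRay.rev, ne_eq, Bool.not_inj_iff]
    rw [show -(-(z + P : ℤ) - 1 + P) - 1 = z by ring, show -(-(z + P : ℤ) - 1) - 1 = z + P by ring]
    exact hz.symm
  · exfalso
    obtain ⟨b, K, hK⟩ := eventually_const_of_not_oscillates h3
    obtain ⟨b', L, hL⟩ := eventually_const_of_not_oscillates h4
    refine hturn ((Set.finite_Icc (-L) K).subset fun z hz => ?_)
    by_contra hmem
    rw [Set.mem_Icc, not_and_or, not_le, not_le] at hmem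
    apply hz
    rcases hmem with hmem | hmem
    · have h5 := hL (-z - 1) (by omega)
      have h6 := hL (-(z - 1) - 1) (by omega)
      rw [← h6] at h5
      simp only [DoubleRay.rev, Bool.not_inj_iff] at h5
      rw [show -(-z - 1) - 1 = z by ring, show -(-(z - 1) - 1) - 1 = z - 1 by ring] at h5
      exact h5.symm
    · rw [hK z (by omega), hK (z - 1) (by omega)]

end Word

end DoubleRay

/-! ### From ordered double rays to words -/

theorem Digraph.IsDoubleRay.exists_isWord {V : Type*} [LinearOrder V] {R : Digraph V}
    (hR : R.IsDoubleRay) : ∃ (e : ℤ ≃o V) (ε : ℤ → Bool), DoubleRay.IsWord ε e.toEquiv R := by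
  classical
  obtain ⟨e⟩ := hR.orderIso_int
  have hcov : ∀ i j, e.symm i ⋖ e.symm j ↔ i + 1 = j := fun i j => by
    rw [apply_covBy_apply_iff, Order.covBy_iff_add_one_eq]
  refine ⟨e.symm, fun i => decide (R.Adj (e.symm i) (e.symm (i + 1))), fun i j => ?_⟩
  have hxor := fun k => hR.xor_adj_of_covBy ((hcov k (k + 1)).2 rfl)
  simp only [decide_eq_true_eq, decide_eq_false_iff_not, RelIso.coe_fn_toEquiv]
  constructor
  · intro h
    rcases hR.covBy_of_adj h with h1 | h1
    · obtain rfl := (hcov _ _).1 h1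
      exact Or.inl ⟨rfl, h⟩
    · obtain rfl := (hcov _ _).1 h1
      refine Or.inr ⟨rfl, fun h2 => ?_⟩
      rcases hxor j with h3 | h3
      · exact h3.2 h
      · exact h3.2 h2
  · rintro (⟨rfl, h⟩ | ⟨rfl, h⟩)
    · exact h
    · rcases hxor j with h3 | h3
      · exact absurd h3.1 h
      · exact h3.1

theorem theorem3p5 {V : Type u} [LinearOrder V] (R : Digraph V)
    (hR : R.IsDoubleRay) (hper : ¬ R.IsPeriodic) (hturns : {v : V | R.IsTurn v}.Infinite) :
    ¬ Digraph.IsUbiquitous.{u, w} R := by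
  obtain ⟨e, ε, hf⟩ := hR.exists_isWord
  refine hf.not_isUbiquitous_of_infinite_turns (fun P hP => ?_) ?_
  · by_contra hP'
    push Not at hP'
    refine hper ⟨fun v => e (e.symm v + P), fun v v' h => ?_, fun v v' h => ?_, fun h => ?_⟩
    · obtain ⟨i, rfl⟩ := e.surjective v
      obtain ⟨j, rfl⟩ := e.surjective v'
      simp only [OrderIso.symm_apply_apply]
      refine (hf _ _).2 ?_
      rw [hP' i, hP' j]
      rcases (hf i j).1 h with ⟨h1, h2⟩ | ⟨h1, h2⟩
      · exact Or.inl ⟨by omega, h2⟩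
      · exact Or.inr ⟨by omega, h2⟩
    · simpa using h
    · have := congrFun h (e 0)
      simp only [OrderIso.symm_apply_apply, id, EmbeddingLike.apply_eq_iff_eq] at this
      omega
  · refine (hturns.preimage (f := e) (by rw [e.range_eq]; exact Set.subset_univ _)).mono
      fun i hi => ?_
    have hi : R.IsTurn (e i) := hi
    have hadj : ∀ i j, R.Adj (e i) (e j) ↔ _ := hf
    intro heq
    rcases hi with ⟨a, b, hab, ha, hb⟩ | ⟨a, b, hab, ha, hb⟩ <;>
    · obtain ⟨j, rfl⟩ := e.surjective a
      obtain ⟨k, rfl⟩ := e.surjective b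
      rw [hadj] at ha hb
      apply hab
      congr 1
      rcases ha with ⟨h1, h2⟩ | ⟨h1, h2⟩ <;> rcases hb with ⟨h3, h4⟩ | ⟨h3, h4⟩
      all_goals first
        | omega
        | (have h5 : i - 1 = k := by omega
           simp [h5, h2, h4] at heq)
        | (have h5 : i - 1 = j := by omega
           simp [h5, h2, h4] at heq)
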